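/- Let $(R,\mathfrak m,k)$ be a (commutative, Noetherian) Cohen–Macaulay local ring with a canonical module $\omega_R$ (a maximal Cohen–Macaulay module of type $1$ and of finite injective dimension) and with $\operatorname{char} k\neq 2$. For an $R$-module $N$ write $N^{\vee}=\operatorname{Hom}_R(N,\omega_R)$. Let $M$ be a finitely generated maximal Cohen–Macaulay $R$-module (that is, $M \neq 0$ and $\operatorname{depth} M=\dim R$) such that 1. $M$ has rank $1$, i.e. $M\otimes_R Q$ is free of rank $1$ over the total ring of fractions $Q$ of $R$, and 2. $\operatorname{Ext}^i_R(M,M^{\vee})=0$ for $1\le i\le \dim R$. Then $M$ is cyclic. If, in addition, $\operatorname{Ext}^{\dim R+1}_R(M,M^{\vee})=0$, then $M\cong R$. -/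

import Mathlib

open CategoryTheory CategoryTheory.Abelian

universe u

namespace CMLocal

variable (R : Type u) [CommRing R] [IsLocalRing R]
variable (M : Type u) [AddCommGroup M] [Module R M]

/-- The depth of a module over a local ring: the supremum of the lengths of the `M`-regular
sequences contained in the maximal ideal. -/
noncomputable def depth : ℕ∞ :=
  ⨆ (rs : List R) (_ : (∀ r ∈ rs, r ∈ IsLocalRing.maximalIdeal R) ∧
    RingTheory.Sequence.IsRegular M rs), (rs.length : ℕ∞)

/-- A (nonzero) Cohen–Macaulay module: finitely generated with depth equal to the Krull
dimension of its support. The zero module, whose support has dimension `⊥`, is excluded. -/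
structure IsCohenMacaulayModule : Prop where
  finite : Module.Finite R M
  depth_eq : ((depth R M : ℕ∞) : WithBot ℕ∞) = Module.supportDim R M

/-- A Cohen–Macaulay local ring: Noetherian, and Cohen–Macaulay as a module over itself. -/
structure IsCohenMacaulayLocalRing : Prop where
  noetherian : IsNoetherianRing R
  cohenMacaulay : IsCohenMacaulayModule R R

/-- A maximal Cohen–Macaulay module: Cohen–Macaulay of dimension `dim R`. -/
structure IsMaximalCohenMacaulay : Prop extends IsCohenMacaulayModule R M where
  dim_eq : Module.supportDim R M = ringKrullDim R

/-- The type `dim_k Ext^t(k, M)`, `t = depth M`, of a module over a local ring with residue field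
`k`. As `Ext^t(k, M)` is killed by the maximal ideal, its `k`-dimension is its length over `R`. -/
noncomputable def moduleType : ℕ∞ :=
  Module.length R (Ext (ModuleCat.of R (IsLocalRing.ResidueField R)) (ModuleCat.of R M)
    (depth R M).toNat)

/-- A canonical module of a (Cohen–Macaulay) local ring: a maximal Cohen–Macaulay module of
type one and of finite injective dimension. -/
structure IsCanonicalModule : Prop extends IsMaximalCohenMacaulay R M where
  type_eq_one : moduleType R M = 1
  finite_injDim : ∃ n : ℕ, HasInjectiveDimensionLE (ModuleCat.of R M) n

/-- `N` has rank `r`: localizing at all nonzerodivisors makes it free of rank `r` over the total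
ring of fractions. -/
def HasRank (A : Type u) [CommRing A] (N : Type u) [AddCommGroup N] [Module A N] (r : ℕ) : Prop :=
  Nonempty (LocalizedModule (nonZeroDivisors A) N ≃ₗ[FractionRing A] (Fin r → FractionRing A))

end CMLocal

/-! It is enough that every bilinear form `M × M → k` is symmetric: if `φ` and `ψ` are functionals
on `k ⊗ M`, symmetry of `φ(a)ψ(b)` forces `k ⊗ M` to have dimension at most one, and Nakayama makes
`M` cyclic.

Such forms are symmetric because they come from forms with values in `ω`. For a maximal `ω`-regular
sequence `rs`, the field `k` embeds in `ω / rs ω`, and `exists_bilinear_lift` lifts the form to `F :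
M × M → ω`. This lifting uses the vanishing of `Ext^i(M, M^∨)` for `1 ≤ i ≤ d` and of `Ext^i(M, ω)`
for `i ≥ 1`; the latter holds because `M` is maximal Cohen–Macaulay and `ω` has finite injective
dimension. Finally `F` is symmetric (`HasRank.bilinear_symm`): `M` has rank one, and nonzerodivisors
of `R` are regular on `ω`.

Rank one also makes `M` faithful, so once cyclic it is free. -/

namespace CMLocal

open IsLocalRing RingTheory.Sequence Pointwise

/-! ### Long exact sequences of Ext -/

section Ext

variable {R : Type u} [CommRing R] {A B C : Type u} [AddCommGroup A] [Module R A]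
  [AddCommGroup B] [Module R B] [AddCommGroup C] [Module R C] {f : A →ₗ[R] B} {g : B →ₗ[R] C}

/-- The short exact sequence of modules attached to a short exact pair of linear maps. -/
lemma shortExact_of_exact (hf : Function.Injective f) (hg : Function.Surjective g)
    (hfg : Function.Exact f g) :
    (ModuleCat.shortComplexOfCompEqZero f g hfg.linearMap_comp_eq_zero).ShortExact :=
  ModuleCat.shortComplex_shortExact _ hfg hf hg

lemma subsingleton_ext_middle (hf : Function.Injective f) (hg : Function.Surjective g)
    (hfg : Function.Exact f g) (W : ModuleCat.{u} R) (n : ℕ)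
    (hA : Subsingleton (Ext (ModuleCat.of R A) W n))
    (hC : Subsingleton (Ext (ModuleCat.of R C) W n)) :
    Subsingleton (Ext (ModuleCat.of R B) W n) := by
  have hS := shortExact_of_exact hf hg hfg
  refine subsingleton_of_forall_eq 0 fun x ↦ ?_
  obtain ⟨y, rfl⟩ := Ext.contravariant_sequence_exact₂ hS W x (hA.elim _ _)
  rw [hC.elim y 0, Ext.comp_zero]

lemma subsingleton_ext_sub (hf : Function.Injective f) (hg : Function.Surjective g)
    (hfg : Function.Exact f g) (W : ModuleCat.{u} R) (n : ℕ)
    (hB : Subsingleton (Ext (ModuleCat.of R B) W n))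
    (hC : Subsingleton (Ext (ModuleCat.of R C) W (n + 1))) :
    Subsingleton (Ext (ModuleCat.of R A) W n) := by
  have hS := shortExact_of_exact hf hg hfg
  refine subsingleton_of_forall_eq 0 fun x ↦ ?_
  obtain ⟨y, rfl⟩ := Ext.contravariant_sequence_exact₁ hS W x (add_comm 1 n) (hC.elim _ _)
  rw [hB.elim y 0, Ext.comp_zero]

lemma subsingleton_ext_quotient (hf : Function.Injective f) (hg : Function.Surjective g)
    (hfg : Function.Exact f g) (W : ModuleCat.{u} R) (n : ℕ)
    (hB : Subsingleton (Ext W (ModuleCat.of R B) n))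
    (hA : Subsingleton (Ext W (ModuleCat.of R A) (n + 1))) :
    Subsingleton (Ext W (ModuleCat.of R C) n) := by
  have hS := shortExact_of_exact hf hg hfg
  refine subsingleton_of_forall_eq 0 fun x ↦ ?_
  obtain ⟨y, rfl⟩ := Ext.covariant_sequence_exact₃ W hS x rfl (hA.elim _ _)
  rw [hB.elim y 0, Ext.zero_comp]

lemma exists_lift_of_subsingleton_ext_one (hf : Function.Injective f)
    (hg : Function.Surjective g) (hfg : Function.Exact f g)
    {W : Type u} [AddCommGroup W] [Module R W]
    (hA : Subsingleton (Ext (ModuleCat.of R W) (ModuleCat.of R A) 1)) (h : W →ₗ[R] C) :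
    ∃ h' : W →ₗ[R] B, g ∘ₗ h' = h := by
  have hS := shortExact_of_exact hf hg hfg
  obtain ⟨y, hy⟩ := Ext.covariant_sequence_exact₃ (ModuleCat.of R W) hS
    (Ext.mk₀ (ModuleCat.ofHom h)) (zero_add 1) (hA.elim _ _)
  obtain ⟨y, rfl⟩ := (Ext.mk₀_bijective _ _).2 y
  rw [Ext.mk₀_comp_mk₀, (Ext.mk₀_bijective _ _).1.eq_iff] at hy
  exact ⟨y.hom, congrArg ModuleCat.Hom.hom hy⟩

lemma subsingleton_ext_of_iso (e : A ≃ₗ[R] B) (W : ModuleCat.{u} R) (n : ℕ)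
    (hA : Subsingleton (Ext (ModuleCat.of R A) W n)) :
    Subsingleton (Ext (ModuleCat.of R B) W n) :=
  -- The isomorphism is read as a short exact sequence with zero third term.
  subsingleton_ext_middle (g := (0 : B →ₗ[R] PUnit.{u + 1})) e.injective
    (Function.surjective_to_subsingleton _)
    ((e.toLinearMap.exact_zero_iff_surjective _).2 e.surjective) W n hA <| by
    have := (ModuleCat.isZero_of_subsingleton (ModuleCat.of R PUnit.{u + 1}))
    refine subsingleton_of_forall_eq 0 fun x ↦ ?_
    rw [← Ext.mk₀_id_comp x, this.eq_zero_of_src (𝟙 _), Ext.mk₀_zero, Ext.zero_comp]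

lemma exact_lsmul_mkQ (x : R) :
    Function.Exact (LinearMap.lsmul R A x) (x • (⊤ : Submodule R A)).mkQ :=
  LinearMap.exact_lsmul_mkQ_smul_top A x

end Ext

/-! ### Vanishing of Ext on finite modules over a local ring -/

section Nakayama

variable {R : Type u} [CommRing R] [IsLocalRing R] [IsNoetherianRing R]

/-- The long exact sequence makes multiplication by `x` surjective on the finite module `Ext^n(A,
W)`, which Nakayama then kills. -/
lemma subsingleton_ext_of_quotSMulTop {A W : Type u} [AddCommGroup A] [Module R A]
    [AddCommGroup W] [Module R W] [Module.Finite R A] [Module.Finite R W] {x : R}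
    (hx : x ∈ maximalIdeal R) (hreg : IsSMulRegular A x) (n : ℕ)
    (h : Subsingleton (Ext (ModuleCat.of R (QuotSMulTop x A)) (ModuleCat.of R W) (n + 1))) :
    Subsingleton (Ext (ModuleCat.of R A) (ModuleCat.of R W) n) := by
  have hS := hreg.smulShortComplex_shortExact (M := ModuleCat.of R A)
  by_contra! ntr
  have : x ∈ (Module.annihilator R
      (Ext (ModuleCat.of R A) (ModuleCat.of R W) n)).jacobson :=
    (IsLocalRing.maximalIdeal_le_jacobson _) hx
  refine Submodule.top_ne_pointwise_smul_of_mem_jacobson_annihilator this ?_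
  rw [eq_comm, eq_top_iff]
  intro y _
  obtain ⟨z, hz⟩ := Ext.contravariant_sequence_exact₁ hS (ModuleCat.of R W) y (add_comm 1 n)
    (h.elim _ _)
  change (Ext.mk₀ (x • 𝟙 (ModuleCat.of R A))).comp
    (show Ext (ModuleCat.of R A) (ModuleCat.of R W) n from z) _ = y at hz
  rw [Ext.mk₀_smul, Ext.smul_comp, Ext.mk₀_id_comp] at hz
  rw [← hz]
  exact Submodule.smul_mem_pointwise_smul _ _ ⊤ trivial

/-- Top-degree vanishing of `Ext(-, W)` on the residue field implies vanishing on all finite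
modules. -/
lemma subsingleton_ext_of_residueField {W : Type u} [AddCommGroup W] [Module R W]
    [Module.Finite R W] (n : ℕ)
    (hk : Subsingleton (Ext (ModuleCat.of R (R ⧸ maximalIdeal R)) (ModuleCat.of R W) n))
    (hsucc : ∀ (N : Type u) [AddCommGroup N] [Module R N] [Module.Finite R N],
      Subsingleton (Ext (ModuleCat.of R N) (ModuleCat.of R W) (n + 1)))
    (N : Type u) [AddCommGroup N] [Module R N] [Module.Finite R N] :
    Subsingleton (Ext (ModuleCat.of R N) (ModuleCat.of R W) n) := by
  have key (p : Ideal R) (hp : p.IsPrime) :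
      Subsingleton (Ext (ModuleCat.of R (R ⧸ p)) (ModuleCat.of R W) n) := by
    induction p using IsNoetherian.induction with
    | hgt p ih =>
    obtain rfl | hne := eq_or_ne p (maximalIdeal R)
    · exact hk
    -- Some `x ∈ 𝔪` outside the prime `p` is regular on `R / p`, so vanishing in degree `n + 1`
    -- descends to degree `n`.
    obtain ⟨x, hxm, hxp⟩ := SetLike.exists_of_lt
      (lt_of_le_of_ne (le_maximalIdeal hp.ne_top) hne)
    refine subsingleton_ext_of_quotSMulTop hxm ?_ n (hsucc _)
    refine isSMulRegular_iff_right_eq_zero_of_smul.mpr fun y hy ↦ ?_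
    obtain ⟨y, rfl⟩ := Ideal.Quotient.mk_surjective y
    rw [Algebra.smul_def, Ideal.Quotient.algebraMap_eq, ← map_mul,
      Ideal.Quotient.eq_zero_iff_mem] at hy
    exact Ideal.Quotient.eq_zero_iff_mem.mpr ((hp.mem_or_mem hy).resolve_left hxp)
  induction ‹Module.Finite R N› using
    IsNoetherianRing.induction_on_isQuotientEquivQuotientPrime R with
  | subsingleton N =>
    have := ModuleCat.isZero_of_subsingleton (ModuleCat.of R N)
    refine subsingleton_of_forall_eq 0 fun x ↦ ?_
    rw [← Ext.mk₀_id_comp x, this.eq_zero_of_src (𝟙 _), Ext.mk₀_zero, Ext.zero_comp]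
  | quotient N p f => exact subsingleton_ext_of_iso f.symm _ n (key p.1 p.2)
  | exact N₁ N₂ N₃ f g hf hg hfg h₁ h₃ =>
    exact subsingleton_ext_middle hf hg hfg _ n h₁ h₃

/-- If `Ext(-, W)` vanishes on finite modules above degree `d`, then on a module with a regular
sequence of length `l` it vanishes above degree `d - l`. -/
lemma subsingleton_ext_of_isWeaklyRegular {W : Type u} [AddCommGroup W] [Module R W]
    [Module.Finite R W] {d : ℕ}
    (hW : ∀ (N : Type u) [AddCommGroup N] [Module R N] [Module.Finite R N] (i : ℕ), d < i →
      Subsingleton (Ext (ModuleCat.of R N) (ModuleCat.of R W) i))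
    (rs : List R) (N : Type u) [AddCommGroup N] [Module R N] [Module.Finite R N]
    (hm : ∀ r ∈ rs, r ∈ maximalIdeal R) (hrs : IsWeaklyRegular N rs) (i : ℕ)
    (hi : d < i + rs.length) :
    Subsingleton (Ext (ModuleCat.of R N) (ModuleCat.of R W) i) := by
  induction rs generalizing N i with
  | nil => exact hW N i hi
  | cons r rs ih =>
    rw [isWeaklyRegular_cons_iff] at hrs
    simp only [List.mem_cons, forall_eq_or_imp] at hm
    rw [List.length_cons] at hi
    exact subsingleton_ext_of_quotSMulTop hm.1 hrs.1 i (ih _ hm.2 hrs.2 (i + 1) (by omega))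

end Nakayama

/-! ### Depth, socles and injective dimension -/

section Depth

variable {R : Type u} [CommRing R] [IsLocalRing R] {M : Type u} [AddCommGroup M] [Module R M]

lemma length_le_depth {rs : List R} (hm : ∀ r ∈ rs, r ∈ maximalIdeal R) (hrs : IsRegular M rs) :
    (rs.length : ℕ∞) ≤ depth R M :=
  le_iSup₂ (f := fun (rs : List R) (_ : (∀ r ∈ rs, r ∈ maximalIdeal R) ∧ IsRegular M rs) ↦
    (rs.length : ℕ∞)) rs ⟨hm, hrs⟩

lemma exists_isRegular_length_eq_depth [Nontrivial M] {d : ℕ} (h : depth R M = d) :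
    ∃ rs : List R, (∀ r ∈ rs, r ∈ maximalIdeal R) ∧ IsRegular M rs ∧ rs.length = d := by
  cases d with
  | zero => exact ⟨[], by simp, .nil R M, rfl⟩
  | succ n =>
    by_contra! hne
    have hle : depth R M ≤ n := iSup₂_le fun rs ⟨hm, hrs⟩ ↦ by
      have h₁ := length_le_depth hm hrs
      have h₂ := hne rs hm hrs
      rw [h, Nat.cast_le] at h₁
      exact Nat.cast_le.mpr (by omega)
    rw [h, Nat.cast_le] at hle
    omega

/-- Modulo a regular sequence of maximal length, the residue field embeds. -/
lemma exists_injective_residueField [IsNoetherianRing R] [Module.Finite R M] {d : ℕ}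
    (h : depth R M = d) {rs : List R} (hm : ∀ r ∈ rs, r ∈ maximalIdeal R)
    (hrs : IsRegular M rs) (hlen : rs.length = d) :
    ∃ f : (R ⧸ maximalIdeal R) →ₗ[R] (M ⧸ (Ideal.ofList rs • ⊤ : Submodule R M)),
      Function.Injective f := by
  set Q := M ⧸ (Ideal.ofList rs • ⊤ : Submodule R M)
  have : Nontrivial Q := hrs.quot_ofList_smul_nontrivial ⊤
  suffices maximalIdeal R ∈ associatedPrimes R Q by
    obtain ⟨-, w, hw⟩ := isAssociatedPrime_iff.mp this
    refine ⟨(maximalIdeal R).liftQ (LinearMap.toSpanSingleton R Q w) fun a ha ↦ ?_, ?_⟩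
    · rw [hw, Submodule.mem_colon_singleton, Submodule.mem_bot] at ha
      exact ha
    · rw [← LinearMap.ker_eq_bot]
      refine Submodule.ker_liftQ_eq_bot _ _ _ fun a ha ↦ ?_
      rw [hw, Submodule.mem_colon_singleton, Submodule.mem_bot]
      exact ha
  -- An element of `𝔪` regular on `Q` would extend `rs` beyond the depth; prime avoidance then puts
  -- `𝔪` inside a single associated prime.
  have hsub : (maximalIdeal R : Set R) ⊆ ⋃ p ∈ associatedPrimes R Q, (id p : Ideal R) := by
    intro x hx
    simp only [id]
    rw [biUnion_associatedPrimes_eq_compl_regular]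
    intro hreg
    have hm' : ∀ r ∈ rs ++ [x], r ∈ maximalIdeal R := by
      simpa [or_imp, forall_and] using ⟨hm, hx⟩
    have : Nontrivial M := hrs.nontrivial
    have hreg' := length_le_depth hm'
      ((isRegular_iff_isWeaklyRegular_of_subset_maximalIdeal hm').mpr
        ((isWeaklyRegular_append_iff M rs [x]).mpr
          ⟨hrs.1, (isWeaklyRegular_singleton_iff _ x).mpr hreg⟩))
    rw [h, Nat.cast_le] at hreg'
    simp at hreg'
    omega
  obtain ⟨p, hp, hle⟩ := (Ideal.subset_union_prime_finite (associatedPrimes.finite R Q) ⊤ ⊤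
    fun p hp _ _ ↦ hp.isPrime).mp hsub
  rwa [(maximalIdeal.isMaximal R).eq_of_le hp.isPrime.ne_top hle]

/-- A finite module of finite injective dimension over a local ring has injective dimension at most
the depth of the ring, as far as finite modules can tell. -/
lemma subsingleton_ext_of_depth_lt [IsNoetherianRing R] [Module.Finite R M] {d : ℕ}
    (hR : depth R R = d) (hM : ∃ n : ℕ, HasInjectiveDimensionLE (ModuleCat.of R M) n)
    (N : Type u) [AddCommGroup N] [Module R N] [Module.Finite R N] (i : ℕ) (hi : d < i) :
    Subsingleton (Ext (ModuleCat.of R N) (ModuleCat.of R M) i) := by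
  obtain ⟨n, hn⟩ := hM
  obtain ⟨rs, hm, hrs, hlen⟩ := exists_isRegular_length_eq_depth hR
  obtain ⟨f, hf⟩ := exists_injective_residueField hR hm hrs hlen
  have hpd : HasProjectiveDimensionLE
      (ModuleCat.of R (R ⧸ (Ideal.ofList rs • ⊤ : Submodule R R))) d := by
    have := ModuleCat.projectiveDimension_quotient_eq_add_length_of_isWeaklyRegular
      (ModuleCat.of R R) rs hrs.1 hm
    rw [ModuleCat.projectiveDimension_eq_zero_of_projective (ModuleCat.of R R), zero_add,
      hlen] at this
    exact (projectiveDimension_le_iff _ d).mp this.le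
  -- Descending induction on the degree `i`, starting above the injective dimension bound `n`.
  suffices ∀ k i : ℕ, d < i → n < i + k → ∀ (N : Type u) [AddCommGroup N] [Module R N]
      [Module.Finite R N], Subsingleton (Ext (ModuleCat.of R N) (ModuleCat.of R M) i) from
    this n i hi (by omega) N
  intro k
  induction k with
  | zero =>
    intro i _ hni N _ _ _
    exact HasInjectiveDimensionLT.subsingleton _ (n + 1) i (by omega) _
  | succ k ih =>
    intro i hdi hni N _ _ _
    have hsucc := ih (i + 1) (by omega) (by omega)
    refine subsingleton_ext_of_residueField i ?_ hsucc N
    -- `Ext^i(k, M)` lies between `Ext^i(R / rs, M)`, zero since `i > d`, and `Ext^(i+1)` of the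
    -- cokernel of `f`.
    exact subsingleton_ext_sub hf (Submodule.mkQ_surjective _) f.exact_map_mkQ_range _ i
      (HasProjectiveDimensionLT.subsingleton _ (d + 1) i (by omega) _) (hsucc _)

end Depth

/-! ### Lifting bilinear forms along a regular sequence -/

section Bilinear

variable {R : Type u} [CommRing R] {M : Type u} [AddCommGroup M] [Module R M]

/-- Bilinear forms with values in `N / rs N` lift to `N`, if `rs` is `N`-regular and sufficiently
many `Ext(M, N)` and `Ext(M, Hom(M, N))` vanish. -/
lemma exists_bilinear_lift (rs : List R) (N : Type u) [AddCommGroup N] [Module R N]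
    (hrs : IsWeaklyRegular N rs)
    (h₁ : ∀ i, 1 ≤ i → i ≤ rs.length →
      Subsingleton (Ext (ModuleCat.of R M) (ModuleCat.of R N) i))
    (h₂ : ∀ i, 1 ≤ i → i ≤ rs.length →
      Subsingleton (Ext (ModuleCat.of R M) (ModuleCat.of R (M →ₗ[R] N)) i))
    (f : M →ₗ[R] M →ₗ[R] (N ⧸ (Ideal.ofList rs • ⊤ : Submodule R N))) :
    ∃ F : M →ₗ[R] M →ₗ[R] N, ∀ a b,
      (Submodule.Quotient.mk (F a b) : N ⧸ (Ideal.ofList rs • ⊤ : Submodule R N)) = f a b := by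
  induction rs generalizing N with
  | nil =>
    let e := Submodule.quotEquivOfEqBot (Ideal.ofList ([] : List R) • ⊤ : Submodule R N)
      (by rw [Ideal.ofList_nil, Submodule.bot_smul])
    exact ⟨f.compr₂ e.toLinearMap, fun a b ↦ e.injective (by simp [e])⟩
  | cons x rs ih =>
    rw [isWeaklyRegular_cons_iff] at hrs
    have hinj : Function.Injective (LinearMap.lsmul R N x) := hrs.1
    have hsurj := (x • (⊤ : Submodule R N)).mkQ_surjective
    have hex := exact_lsmul_mkQ (A := N) x
    let π : (M →ₗ[R] N) →ₗ[R] (M →ₗ[R] QuotSMulTop x N) :=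
      LinearMap.compRight R (x • (⊤ : Submodule R N)).mkQ
    have hinj' : Function.Injective (LinearMap.lsmul R (M →ₗ[R] N) x) := fun a b hab ↦
      LinearMap.ext fun m ↦ hrs.1 (DFunLike.congr_fun hab m)
    have hsurj' : Function.Surjective π := fun g ↦
      exists_lift_of_subsingleton_ext_one hinj hsurj hex (h₁ 1 le_rfl (by simp)) g
    -- With `hsurj'`, this identifies `Hom(M, N / xN)` with `Hom(M, N) / x Hom(M, N)`, so both
    -- families of Ext hypotheses pass to `N / xN`.
    have hex' : Function.Exact (LinearMap.lsmul R (M →ₗ[R] N) x) π := by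
      intro g
      constructor
      · intro hg
        have hg' (m : M) : ∃ y, x • y = g m := (hex (g m)).mp (DFunLike.congr_fun hg m)
        choose y hy using hg'
        exact ⟨⟨⟨y, fun a b ↦ hrs.1 (by simp [hy])⟩,
          fun r a ↦ hrs.1 (by simp [hy, smul_comm x r])⟩, LinearMap.ext hy⟩
      · rintro ⟨g, rfl⟩
        exact LinearMap.ext fun m ↦ (hex _).mpr ⟨g m, rfl⟩
    let e := Submodule.quotOfListConsSMulTopEquivQuotSMulTopInner N x rs
    -- Vanishing in degree `i` over `N / xN` needs degrees `i` and `i + 1` over `N`; the degree lost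
    -- is matched by the shorter sequence.
    obtain ⟨F₁, hF₁⟩ := ih (QuotSMulTop x N) hrs.2
      (fun i hi hi' ↦ subsingleton_ext_quotient hinj hsurj hex _ i
        (h₁ i hi (by simp; omega)) (h₁ (i + 1) (by omega) (by simpa using hi')))
      (fun i hi hi' ↦ subsingleton_ext_quotient hinj' hsurj' hex' _ i
        (h₂ i hi (by simp; omega)) (h₂ (i + 1) (by omega) (by simpa using hi')))
      (f.compr₂ e.toLinearMap)
    obtain ⟨F, hF⟩ := exists_lift_of_subsingleton_ext_one hinj' hsurj' hex'
      (h₂ 1 le_rfl (by simp)) F₁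
    refine ⟨F, fun a b ↦ e.injective ?_⟩
    refine Eq.trans ?_ (hF₁ a b)
    rw [← hF]
    rfl

end Bilinear

/-! ### Modules of rank one -/

section Rank

variable {R : Type u} [CommRing R] {M : Type u} [AddCommGroup M] [Module R M]

/-- A module of rank one is, up to multiplication by nonzerodivisors, spanned by one element. -/
lemma HasRank.exists_smul_eq_smul (h : HasRank R M 1) :
    ∃ m₀ : M, ∀ a : M, ∃ v ∈ nonZeroDivisors R, ∃ c : R, v • a = c • m₀ := by
  obtain ⟨e⟩ := h
  induction hz : e.symm 1 using LocalizedModule.induction_on with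
  | h m₀ s₀ =>
  refine ⟨m₀, fun a ↦ ?_⟩
  have ha : LocalizedModule.mk a 1 = e (LocalizedModule.mk a 1) 0 • LocalizedModule.mk m₀ s₀ := by
    apply e.injective
    rw [map_smul, ← hz, e.apply_symm_apply]
    ext i
    fin_cases i
    simp
  obtain ⟨⟨c, s⟩, hcs⟩ := Localization.mkHom_surjective (e (LocalizedModule.mk a 1) 0)
  rw [← hcs] at ha
  erw [LocalizedModule.mk_smul_mk] at ha
  rw [LocalizedModule.mk_eq] at ha
  obtain ⟨u, hu⟩ := ha
  refine ⟨u * (s * s₀), (u * (s * s₀)).2, u * c, ?_⟩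
  simpa [mul_smul, Submonoid.smul_def] using hu

lemma HasRank.eq_zero_of_forall_smul_eq_zero (h : HasRank R M 1) {r : R}
    (hr : ∀ m : M, r • m = 0) : r = 0 := by
  obtain ⟨e⟩ := h
  apply IsFractionRing.injective R (FractionRing R)
  have hz : ∀ z : LocalizedModule (nonZeroDivisors R) M,
      algebraMap R (FractionRing R) r • z = 0 := fun z ↦ by
    induction z using LocalizedModule.induction_on with
    | h m s => rw [algebraMap_smul, LocalizedModule.smul'_mk, hr, LocalizedModule.zero_mk]
  have := hz (e.symm 1)
  rw [← map_smul, e.symm.map_eq_zero_iff] at this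
  simpa using congrFun this 0

/-- If `v • a = c • m₀` and `w • b = d • m₀`, then `F a b` and `F b a` both become `cd F(m₀, m₀)`
after multiplication by `wv`, which can be cancelled in `N`. -/
lemma HasRank.bilinear_symm (h : HasRank R M 1) {N : Type u} [AddCommGroup N] [Module R N]
    (hN : ∀ s ∈ nonZeroDivisors R, IsSMulRegular N s) (F : M →ₗ[R] M →ₗ[R] N) (a b : M) :
    F a b = F b a := by
  obtain ⟨m₀, hm₀⟩ := h.exists_smul_eq_smul
  obtain ⟨v, hv, c, hc⟩ := hm₀ a
  obtain ⟨w, hw, d, hd⟩ := hm₀ b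
  apply hN v hv
  apply hN w hw
  have h₁ : w • v • F a b = F (v • a) (w • b) := by simp
  have h₂ : w • v • F b a = F (w • b) (v • a) := by simp [smul_comm w v]
  change w • v • F a b = w • v • F b a
  rw [h₁, h₂, hc, hd]
  simp [smul_comm c d]

/-- The annihilator of a generator kills all of `M`, hence is zero by faithfulness. -/
lemma HasRank.nonempty_linearEquiv_of_span_singleton (h : HasRank R M 1) {x : M}
    (hx : Submodule.span R {x} = ⊤) : Nonempty (M ≃ₗ[R] R) := by
  refine ⟨(LinearEquiv.ofBijective (LinearMap.toSpanSingleton R M x) ⟨?_, ?_⟩).symm⟩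
  · rw [← LinearMap.ker_eq_bot, LinearMap.ker_eq_bot']
    intro r hr
    refine h.eq_zero_of_forall_smul_eq_zero fun m ↦ ?_
    obtain ⟨c, rfl⟩ := Submodule.mem_span_singleton.mp (hx ▸ Submodule.mem_top : m ∈ _)
    rw [smul_comm, show r • x = 0 from hr, smul_zero]
  · rw [← LinearMap.range_eq_top, LinearMap.range_toSpanSingleton, hx]

end Rank

/-! ### Associated primes, depth and dimension -/

section Dimension

variable {R : Type u} [CommRing R] [IsLocalRing R] [IsNoetherianRing R]

/-- Let `L` be the nonzero submodule of elements killed by `p`. As `x` is regular, `L / xL` embeds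
in `N / xN`; it is nonzero by Nakayama and killed by `p` and `x`, so any associated prime of it
serves as `q`. -/
lemma exists_mem_associatedPrimes_quotSMulTop {N : Type u} [AddCommGroup N] [Module R N]
    [Module.Finite R N] {x : R} (hx : x ∈ maximalIdeal R) (hreg : IsSMulRegular N x)
    {p : Ideal R} (hp : p ∈ associatedPrimes R N) :
    ∃ q ∈ associatedPrimes R (QuotSMulTop x N), p ≤ q ∧ x ∈ q := by
  obtain ⟨hp', w, hw⟩ := isAssociatedPrime_iff.mp hp
  have hw' (a : R) : a ∈ p ↔ a • w = 0 := by
    rw [hw, Submodule.mem_colon_singleton, Submodule.mem_bot]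
  let L : Submodule R N := Submodule.torsionBySet R N p
  have hL : Nontrivial L := by
    refine ⟨⟨⟨w, ?_⟩, 0, fun h0 ↦ hp'.ne_top ((Ideal.eq_top_iff_one p).mpr ?_)⟩⟩
    · rw [Submodule.mem_torsionBySet_iff]
      exact fun a ↦ (hw' a).mp a.2
    · rw [hw', one_smul]
      exact congrArg Subtype.val h0
  have : Nontrivial (QuotSMulTop x L) := nontrivial_quotSMulTop_of_mem_maximalIdeal L hx
  obtain ⟨q, hq⟩ := associatedPrimes.nonempty R (QuotSMulTop x L)
  have hann : Module.annihilator R (QuotSMulTop x L) ≤ q := by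
    simpa [Submodule.annihilator_top] using hq.annihilator_le
  refine ⟨q, associatedPrimes.subset_of_injective (f := QuotSMulTop.map x L.subtype) ?_ hq,
    fun a ha ↦ hann ?_, hann (QuotSMulTop.mem_annihilator L x)⟩
  · rw [← LinearMap.ker_eq_bot, LinearMap.ker_eq_bot']
    intro y hy
    obtain ⟨⟨y, hyL⟩, rfl⟩ := Submodule.mkQ_surjective _ y
    have hy' : y ∈ x • (⊤ : Submodule R N) := (Submodule.Quotient.mk_eq_zero _).mp hy
    obtain ⟨w, -, rfl⟩ := hy'
    refine (Submodule.Quotient.mk_eq_zero _).mpr ⟨⟨w, ?_⟩, trivial, rfl⟩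
    rw [Submodule.mem_torsionBySet_iff] at hyL ⊢
    intro a
    apply hreg
    simpa [smul_comm x] using hyL a
  · rw [Module.mem_annihilator]
    intro y
    obtain ⟨⟨y, hyL⟩, rfl⟩ := Submodule.mkQ_surjective _ y
    rw [← map_smul]
    have : a • (⟨y, hyL⟩ : L) = 0 :=
      Subtype.ext ((Submodule.mem_torsionBySet_iff _ _).mp hyL ⟨a, ha⟩)
    rw [this, map_zero]

/-- The dimension of `R / p` for an associated prime `p` of `N` bounds the depth of `N`. -/
lemma length_le_ringKrullDim_quotient_of_mem_associatedPrimes (rs : List R) (N : Type u)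
    [AddCommGroup N] [Module R N] [Module.Finite R N] (hm : ∀ r ∈ rs, r ∈ maximalIdeal R)
    (hrs : IsWeaklyRegular N rs) {p : Ideal R} (hp : p ∈ associatedPrimes R N) :
    (rs.length : WithBot ℕ∞) ≤ ringKrullDim (R ⧸ p) := by
  induction rs generalizing N p with
  | nil =>
    have : Nontrivial (R ⧸ p) := Ideal.Quotient.nontrivial_iff.mpr hp.isPrime.ne_top
    simpa using ringKrullDim_nonneg_of_nontrivial
  | cons x rs ih =>
    rw [isWeaklyRegular_cons_iff] at hrs
    simp only [List.mem_cons, forall_eq_or_imp] at hm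
    obtain ⟨q, hq, hpq, hxq⟩ := exists_mem_associatedPrimes_quotSMulTop hm.1 hrs.1 hp
    have hxp : x ∉ p := fun hxp ↦ by
      have : x ∈ ⋃ p ∈ associatedPrimes R N, (p : Set R) := Set.mem_biUnion hp hxp
      rw [biUnion_associatedPrimes_eq_compl_regular] at this
      exact this hrs.1
    have := hp.isPrime
    have hnz : Ideal.Quotient.mk p x ∈ nonZeroDivisors (R ⧸ p) :=
      mem_nonZeroDivisors_of_ne_zero (by rwa [ne_eq, Ideal.Quotient.eq_zero_iff_mem])
    refine le_trans ?_ (ringKrullDim_quotient_succ_le_of_nonZeroDivisor hnz)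
    rw [List.length_cons, Nat.cast_add, Nat.cast_one]
    gcongr
    refine (ih _ hm.2 hrs.2 hq).trans ?_
    refine ringKrullDim_le_of_surjective
      (Ideal.Quotient.lift _ (Ideal.Quotient.factor hpq) ?_) ?_
    · intro a ha
      have hle : Ideal.span {Ideal.Quotient.mk p x} ≤ RingHom.ker (Ideal.Quotient.factor hpq) := by
        rw [Ideal.span_singleton_le_iff_mem, RingHom.mem_ker, Ideal.Quotient.factor_mk]
        exact Ideal.Quotient.eq_zero_iff_mem.mpr hxq
      exact hle ha
    · exact Ideal.Quotient.lift_surjective_of_surjective _ _ (Ideal.Quotient.factor_surjective hpq)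

/-- Otherwise `s` lies in an associated prime `p` of `N`. Then `dim R / p ≥ dim R` by the depth
bound, while `dim R / p ≤ dim R / (s) < dim R`. -/
lemma isSMulRegular_of_mem_nonZeroDivisors {N : Type u} [AddCommGroup N] [Module R N]
    [Module.Finite R N] {rs : List R} (hm : ∀ r ∈ rs, r ∈ maximalIdeal R)
    (hrs : IsWeaklyRegular N rs) (hdim : ringKrullDim R = rs.length) {s : R}
    (hs : s ∈ nonZeroDivisors R) : IsSMulRegular N s := by
  by_contra hsN
  have : s ∈ ⋃ p ∈ associatedPrimes R N, (p : Set R) := by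
    rwa [biUnion_associatedPrimes_eq_compl_regular]
  simp only [Set.mem_iUnion, SetLike.mem_coe, exists_prop] at this
  obtain ⟨p, hp, hsp⟩ := this
  have h₁ := length_le_ringKrullDim_quotient_of_mem_associatedPrimes rs N hm hrs hp
  have h₂ := ringKrullDim_quotient_succ_le_of_nonZeroDivisor hs
  have h₃ : ringKrullDim (R ⧸ p) ≤ ringKrullDim (R ⧸ Ideal.span {s}) :=
    ringKrullDim_le_of_surjective _
      (Ideal.Quotient.factor_surjective ((Ideal.span_singleton_le_iff_mem p).mpr hsp))
  have h₄ : ((rs.length : ℕ) : WithBot ℕ∞) + 1 ≤ (rs.length : ℕ) :=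
    (add_le_add_left (h₁.trans h₃) 1).trans (h₂.trans hdim.le)
  have h₅ : ((rs.length + 1 : ℕ) : WithBot ℕ∞) ≤ (rs.length : ℕ) := by exact_mod_cast h₄
  rw [Nat.cast_le] at h₅
  omega

end Dimension

/-! ### Cyclicity from symmetry of bilinear forms -/

section Cyclic

variable {R : Type u} [CommRing R] [IsLocalRing R] {M : Type u} [AddCommGroup M] [Module R M]

/-- If every bilinear form with values in the residue field is symmetric, the module is cyclic. -/
lemma exists_span_singleton_eq_top [Module.Finite R M]
    (h : ∀ (f : M →ₗ[R] M →ₗ[R] ResidueField R) (a b : M), f a b = f b a) :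
    ∃ x : M, Submodule.span R {x} = ⊤ := by
  set k := ResidueField R
  let ι : M →ₗ[R] TensorProduct R k M := TensorProduct.mk R k M 1
  by_cases hφ : ∃ (φ : Module.Dual k (TensorProduct R k M)) (x : M), φ (ι x) ≠ 0
  · obtain ⟨φ, x, hx⟩ := hφ
    refine ⟨x, ?_⟩
    rw [← IsLocalRing.map_tensorProduct_mk_eq_top, eq_top_iff]
    have hspan : ∀ y : M, ι y = (φ (ι y) / φ (ι x)) • ι x := fun y ↦ by
      rw [← sub_eq_zero, ← Module.forall_dual_apply_eq_zero_iff k]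
      intro ψ
      -- Symmetry of the form `φ(a)ψ(b)` at `(x, y)` shows that every functional `ψ` agrees on the
      -- two sides.
      have := h ((LinearMap.mul R k).compl₁₂ (φ.restrictScalars R ∘ₗ ι)
        (ψ.restrictScalars R ∘ₗ ι)) x y
      have : φ (ι x) * ψ (ι y) = φ (ι y) * ψ (ι x) := this
      rw [map_sub, map_smul, smul_eq_mul, sub_eq_zero]
      rw [div_mul_eq_mul_div, ← this, mul_div_cancel_left₀ _ hx]
    intro z _
    induction z using TensorProduct.induction_on with
    | zero => exact zero_mem _
    | add a b ha hb => exact add_mem (ha trivial) (hb trivial)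
    | tmul c y =>
      have h₁ : c ⊗ₜ[R] y = c • ι y := by simp [ι, TensorProduct.smul_tmul']
      obtain ⟨r, hr⟩ := residue_surjective (c * (φ (ι y) / φ (ι x)))
      rw [h₁, hspan y, smul_smul, ← hr, ← ResidueField.algebraMap_eq, algebraMap_smul]
      exact ⟨r • x, Submodule.smul_mem _ _ (Submodule.mem_span_singleton_self x), map_smul ι r x⟩
  -- Here `k ⊗ M = 0`, so Nakayama allows the generator `0`.
  · push Not at hφ
    refine ⟨0, ?_⟩
    rw [← IsLocalRing.map_tensorProduct_mk_eq_top, eq_top_iff]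
    have h0 : ∀ y : M, ι y = 0 := fun y ↦
      (Module.forall_dual_apply_eq_zero_iff k _).mp fun φ ↦ hφ φ y
    intro z _
    induction z using TensorProduct.induction_on with
    | zero => exact zero_mem _
    | add a b ha hb => exact add_mem (ha trivial) (hb trivial)
    | tmul c y =>
      have h₁ : c ⊗ₜ[R] y = c • ι y := by simp [ι, TensorProduct.smul_tmul']
      rw [h₁, h0, smul_zero]
      exact zero_mem _

end Cyclic

/-! ### Maximal regular sequences on Cohen–Macaulay modules, and the theorem -/

lemma IsCohenMacaulayModule.nontrivial {R : Type u} [CommRing R] [IsLocalRing R] {M : Type u}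
    [AddCommGroup M] [Module R M] (h : IsCohenMacaulayModule R M) : Nontrivial M := by
  rw [← Module.supportDim_ne_bot_iff_nontrivial R, ← h.depth_eq]
  exact WithBot.coe_ne_bot

lemma IsCohenMacaulayModule.exists_isRegular {R : Type u} [CommRing R] [IsLocalRing R] {M : Type u}
    [AddCommGroup M] [Module R M] (h : IsCohenMacaulayModule R M) {d : ℕ}
    (hd : Module.supportDim R M = d) : depth R M = d ∧
    ∃ rs : List R, (∀ r ∈ rs, r ∈ maximalIdeal R) ∧ IsRegular M rs ∧ rs.length = d := by
  have := h.nontrivial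
  have hdepth : depth R M = d := WithBot.coe_injective (h.depth_eq.trans hd)
  exact ⟨hdepth, exists_isRegular_length_eq_depth hdepth⟩

end CMLocal

theorem corollary3p10 {R : Type u} [CommRing R] [IsLocalRing R]
    (hR : CMLocal.IsCohenMacaulayLocalRing R)
    (hchar : ringChar (IsLocalRing.ResidueField R) ≠ 2)
    {ω : Type u} [AddCommGroup ω] [Module R ω] (hω : CMLocal.IsCanonicalModule R ω)
    {M : Type u} [AddCommGroup M] [Module R M] (hM : CMLocal.IsMaximalCohenMacaulay R M)
    (hrank : CMLocal.HasRank R M 1)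
    (d : ℕ) (hd : ringKrullDim R = (d : WithBot ℕ∞))
    (hExt : ∀ i : ℕ, 1 ≤ i → i ≤ d →
      Subsingleton (Ext (ModuleCat.of R M) (ModuleCat.of R (M →ₗ[R] ω)) i)) :
    (∃ x : M, Submodule.span R {x} = ⊤) ∧
      (Subsingleton (Ext (ModuleCat.of R M) (ModuleCat.of R (M →ₗ[R] ω)) (d + 1)) →
        Nonempty (M ≃ₗ[R] R)) := by
  have := hR.noetherian
  have := hω.finite
  have := hM.finite
  obtain ⟨hdR, -⟩ := hR.cohenMacaulay.exists_isRegular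
    ((Module.supportDim_self_eq_ringKrullDim R).trans hd)
  obtain ⟨-, xs, hxs, hxsM, hxd⟩ := hM.toIsCohenMacaulayModule.exists_isRegular
    (hM.dim_eq.trans hd)
  obtain ⟨hdω, rs, hrs, hrsω, hrd⟩ := hω.toIsCohenMacaulayModule.exists_isRegular
    (hω.dim_eq.trans hd)
  -- Finite injective dimension gives vanishing above degree `d`; the `M`-regular sequence `xs` of
  -- length `d` lowers this to all positive degrees.
  have hext (i : ℕ) (hi : 1 ≤ i) :
      Subsingleton (Ext (ModuleCat.of R M) (ModuleCat.of R ω) i) :=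
    CMLocal.subsingleton_ext_of_isWeaklyRegular (d := d)
      (CMLocal.subsingleton_ext_of_depth_lt hdR hω.finite_injDim) xs M hxs hxsM.1 i (by omega)
  obtain ⟨j, hj⟩ := CMLocal.exists_injective_residueField hdω hrs hrsω hrd
  have hcyc : ∃ x : M, Submodule.span R {x} = ⊤ := by
    refine CMLocal.exists_span_singleton_eq_top fun f a b ↦ hj ?_
    obtain ⟨F, hF⟩ := CMLocal.exists_bilinear_lift rs ω hrsω.1 (fun i hi _ ↦ hext i hi)
      (fun i hi hi' ↦ hExt i hi (hrd ▸ hi')) (f.compr₂ j)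
    have hsymm := hrank.bilinear_symm (fun s hs ↦
      CMLocal.isSMulRegular_of_mem_nonZeroDivisors hrs hrsω.1 (hd.trans (by rw [hrd])) hs) F a b
    exact (hF a b).symm.trans ((congrArg _ hsymm).trans (hF b a))
  exact ⟨hcyc, fun _ ↦ hcyc.elim fun x hx ↦ hrank.nonempty_linearEquiv_of_span_singleton hx⟩
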